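/- Let $G=(V,E)$ be a finite simple graph. For $U\subseteq V$ and a set $B\subseteq U$ of blue vertices of the induced subgraph $G[U]$ (the other vertices of $U$ being white), a blue vertex $u$ forces a white vertex $v$ if $v$ is the only white neighbour of $u$ in $G[U]$; then $v$ turns blue. Let $\mathsf{White}(S,G[U])$ be the set of vertices of $U$ that remain white when only $S\subseteq U$ is blue at first and forcing is applied as long as possible; $S$ is a zero forcing set of $G[U]$ if $\mathsf{White}(S,G[U])=\emptyset$. For every zero forcing set $S$ of $G[U]$, let $\mathsf{FAS}(S,G[U])$ be an arbitrarily chosen forcing arc set representing a zero forcing process on $G[U]$ that starts from $S$ and turns all of $U$ blue, that is, the set of all pairs $(u,v)$ such that $u$ forces $v$ in a step of this process, each vertex outside $S$ being forced by exactly one vertex. For $A\subseteq V\times V$ let $\overleftarrow{A}=\{(v,u):(u,v)\in A\}$, and let $\mathsf{Sources}(A,U)$ be the set of those $v\in U$ for which there is no pair $(u,v)\in A$. A nice path decomposition of $G$ is a sequence $X_0,X_1,\dots,X_{k+1}$ of subsets of $V$ such that: every vertex lies in some $X_i$ with $1\le i\le k$; for every edge $uv$ there is $1\le i\le k$ with $\{u,v\}\subseteq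 X_i$; if $1\le i<j\le k$ and $v\in X_i\cap X_j$, then $v\in X_s$ for all $i\le s\le j$; $X_0=X_{k+1}=\emptyset$ and $X_i\neq\emptyset$ for $1\le i\le k$; and for $0\le i\le k$ either $X_{i+1}=X_i\cup\{v\}$ for some $v\in V\setminus X_i$ or $X_{i+1}=X_i\setminus\{v\}$ for some $v\in X_i$. Write $X_i^j=X_i\cup X_{i+1}\cup\dots\cup X_j$ and $G(i,j)=G[X_i^j]$. Consider the following algorithm with input $G$ and a nice path decomposition $X_0,\dots,X_{k+1}$ of $G$. 1. Set $t\leftarrow 0$, $S\leftarrow\emptyset$, $A\leftarrow\emptyset$, $\mathcal F\leftarrow\emptyset$. 2. Set $z\leftarrow t$, $W\leftarrow\emptyset$. 3. While $W=\emptyset$ and $z\le k$: set $z\leftarrow z+1$, and then $W\leftarrow\mathsf{White}(X_t\cup X_z,G(t,z))$. 4. Set $A\leftarrow\overleftarrow{A}$ and then $S\leftarrow\mathsf{Sources}(A,X_0^t)$. 5. If $W\neq\emptyset$: add $W$ to $\mathcal F$; set $S\leftarrow S\cup X_{z-1}$; set $A'\leftarrow A\cup\mathsf{FAS}(X_t\cup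 X_{z-1},G(t,z))$; set $A\leftarrow\{(u,v)\in A': v\notin X_z\}$; set $t\leftarrow z$ and go to step 2. 6. If $W=\emptyset$: set $A\leftarrow A\cup\mathsf{FAS}(X_t,G(t,z))$. 7. Return $S$ and $\mathcal F$. **Theorem.** For every finite simple graph $G$, every nice path decomposition of $G$ and every choice of the forcing arc sets $\mathsf{FAS}$, the set $S$ returned by the algorithm is a zero forcing set of $G$. -/

import Mathlib

/-!
Zero forcing on a simple graph `G`, forcing arc sets, nice path decompositions, and the zero forcing
set algorithm that is driven by a nice path decomposition.

Every notion is given for the induced subgraph `G[U]`, where `U` is a set of vertices of `G`;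
the graph `G` itself is the case `U = Set.univ`.
-/

namespace ZeroForcing

variable {V : Type*}

/-- The colour change rule in `G[U]` with blue set `B`: the blue vertex `u` forces the white vertex
`v`, that is, `v` is the only white neighbour of `u` in `G[U]`. -/
def Forces (G : SimpleGraph V) (U B : Set V) (u v : V) : Prop :=
  u ∈ U ∧ u ∈ B ∧ v ∈ U ∧ v ∉ B ∧ G.Adj u v ∧ ∀ w ∈ U, G.Adj u w → w ∉ B → w = v

/-- The blue set of the derived colouring of `S` in `G[U]`: the vertices that turn blue when
only `S` is blue at first and the colour change rule is applied as long as possible. -/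
inductive Derived (G : SimpleGraph V) (U S : Set V) : V → Prop
  | init {v : V} (hv : v ∈ S) : Derived G U S v
  | force {u v : V} (hu : u ∈ U) (hv : v ∈ U) (huv : G.Adj u v) (hblue : Derived G U S u)
      (hrest : ∀ w ∈ U, G.Adj u w → w ≠ v → Derived G U S w) : Derived G U S v

/-- `White(S, G[U])`: the vertices that remain white after the zero forcing process on `G[U]` with
initial blue set `S`. -/
def white (G : SimpleGraph V) (U S : Set V) : Set V :=
  {v | v ∈ U ∧ ¬ Derived G U S v}

/-- `S` is a zero forcing set of `G[U]`. -/
def IsZeroForcingSetOn (G : SimpleGraph V) (U S : Set V) : Prop :=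
  S ⊆ U ∧ ∀ v ∈ U, Derived G U S v

/-- `S` is a zero forcing set of `G`. -/
def IsZeroForcingSet (G : SimpleGraph V) (S : Set V) : Prop :=
  IsZeroForcingSetOn G Set.univ S

/-- `ForcingRun G U B A`: there is a zero forcing process on `G[U]`, forcing one vertex in each step,
that starts with blue set `B` and ends with all of `U` blue, such that `(u, v) ∈ A` precisely if
`u` forces `v` in one of its steps. -/
inductive ForcingRun (G : SimpleGraph V) (U : Set V) : Set V → Set (V × V) → Prop
  | done : ForcingRun G U U ∅
  | step {B : Set V} {A : Set (V × V)} {u v : V} (huv : Forces G U B u v)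
      (hrest : ForcingRun G U (B ∪ {v}) A) : ForcingRun G U B (A ∪ {(u, v)})

/-- `A` is a forcing arc set of `G[U]` that represents a zero forcing process with initial blue
set `S` (each vertex being forced by one vertex only).
The digraph `(U, A)` is then a disjoint union of dipaths, whose sources form the set `S`. -/
def IsForcingArcSetFrom (G : SimpleGraph V) (U S : Set V) (A : Set (V × V)) : Prop :=
  S ⊆ U ∧ ForcingRun G U S A

/-- `fas` is a choice of representatives `FAS(S, G[U])`: it picks, for each vertex set `U` and each
zero forcing set `S` of `G[U]`, some forcing arc set `fas U S` representing a zero forcing process on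
`G[U]` with initial blue set `S`. The values at other arguments are arbitrary. -/
def IsForcingArcChoice (G : SimpleGraph V) (fas : Set V → Set V → Set (V × V)) : Prop :=
  ∀ U S : Set V, IsZeroForcingSetOn G U S → IsForcingArcSetFrom G U S (fas U S)

/-- The reverse of an arc set. -/
def reverse (A : Set (V × V)) : Set (V × V) :=
  {a | (a.2, a.1) ∈ A}

/-- The sources (vertices of in-degree zero) of the digraph `(U, A)`. -/
def sources (A : Set (V × V)) (U : Set V) : Set V :=
  {v | v ∈ U ∧ ∀ u, (u, v) ∉ A}

/-- `X 0, X 1, …, X (k + 1)` is a nice path decomposition of `G`. (The values `X i` with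
`i > k + 1` play no role.) -/
structure IsNicePathDecomposition (G : SimpleGraph V) (k : ℕ) (X : ℕ → Set V) : Prop where
  vertex_mem : ∀ v : V, ∃ i, 1 ≤ i ∧ i ≤ k ∧ v ∈ X i
  edge_mem : ∀ u v : V, G.Adj u v → ∃ i, 1 ≤ i ∧ i ≤ k ∧ u ∈ X i ∧ v ∈ X i
  interval : ∀ (v : V) (i j : ℕ), 1 ≤ i → i < j → j ≤ k → v ∈ X i → v ∈ X j →
    ∀ s, i ≤ s → s ≤ j → v ∈ X s
  first_empty : X 0 = ∅
  last_empty : X (k + 1) = ∅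
  nonempty : ∀ i, 1 ≤ i → i ≤ k → (X i).Nonempty
  succ_bag : ∀ i, i ≤ k →
    (∃ v, v ∉ X i ∧ X (i + 1) = X i ∪ {v}) ∨ (∃ v, v ∈ X i ∧ X (i + 1) = X i \ {v})

/-- The union `X i ∪ X (i + 1) ∪ ⋯ ∪ X j`; it is the vertex set of `G(i, j) = G[X_i^j]`. -/
def bagUnion (X : ℕ → Set V) (i j : ℕ) : Set V :=
  {v | ∃ s, i ≤ s ∧ s ≤ j ∧ v ∈ X s}

open Classical in
/-- The inner loop, entered with the values `z` and `W`; it returns the final values of `z`, `W`: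
while `W = ∅` and `z ≤ k`, set `z ← z + 1` and then `W ← White(X_t ∪ X_z, G(t, z))`. -/
noncomputable def scan (G : SimpleGraph V) (k : ℕ) (X : ℕ → Set V) (t z : ℕ) (W : Set V) :
    ℕ × Set V :=
  if W = ∅ ∧ z ≤ k then
    scan G k X t (z + 1) (white G (bagUnion X t (z + 1)) (X t ∪ X (z + 1)))
  else (z, W)
termination_by k + 1 - z

/-- Termination fact: a scan from `W = ∅` that ends with `W ≠ ∅` has increased `z`, and
`z ≤ k + 1`. -/
theorem scan_bounds (G : SimpleGraph V) (k : ℕ) (X : ℕ → Set V) (t z : ℕ)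
    (h : (scan G k X t z ∅).2 ≠ ∅) :
    z < (scan G k X t z ∅).1 ∧ (scan G k X t z ∅).1 ≤ k + 1 := by
  have key : ∀ (n z : ℕ) (W : Set V), n = k + 1 - z → z ≤ k + 1 →
      z ≤ (scan G k X t z W).1 ∧ (scan G k X t z W).1 ≤ k + 1 := by
    intro n
    induction n with
    | zero =>
      intro z W hn hz
      rw [scan, if_neg (by omega)]
      exact ⟨le_rfl, hz⟩
    | succ n ih =>
      intro z W hn hz
      rw [scan]
      split_ifs with hc
      · have := ih (z + 1) (white G (bagUnion X t (z + 1)) (X t ∪ X (z + 1)))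
          (by omega) (by omega)
        exact ⟨by omega, this.2⟩
      · exact ⟨le_rfl, hz⟩
  rw [scan] at h ⊢
  split_ifs at h ⊢ with hc
  · have := key _ (z + 1) (white G (bagUnion X t (z + 1)) (X t ∪ X (z + 1))) rfl (by omega)
    exact ⟨by omega, this.2⟩
  · exact absurd rfl h

/-- The variables of the algorithm that survive an iteration: the index `t`, the vertex set `S`,
the arc set `A` and the family `forts`. -/
structure State (V : Type*) where
  t : ℕ
  S : Set V
  A : Set (V × V)
  forts : Set (Set V)

open Classical in
/-- The algorithm, resumed at the line `z ← t, W ← ∅` in state `σ`; it returns the final state. -/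
noncomputable def run (G : SimpleGraph V) (k : ℕ) (X : ℕ → Set V)
    (fas : Set V → Set V → Set (V × V)) (σ : State V) : State V :=
  let z := (scan G k X σ.t σ.t ∅).1
  let W := (scan G k X σ.t σ.t ∅).2
  let A₁ := reverse σ.A
  let S₁ := sources A₁ (bagUnion X 0 σ.t)
  if h : W ≠ ∅ then
    let A' := A₁ ∪ fas (bagUnion X σ.t z) (X σ.t ∪ X (z - 1))
    run G k X fas
      { t := z
        S := S₁ ∪ X (z - 1)
        A := {a | a ∈ A' ∧ a.2 ∉ X z}
        forts := σ.forts ∪ {W} }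
  else
    { t := σ.t
      S := S₁
      A := A₁ ∪ fas (bagUnion X σ.t z) (X σ.t)
      forts := σ.forts }
termination_by k + 1 - σ.t
decreasing_by
  have hb := scan_bounds G k X σ.t σ.t h
  omega

/-- The pair `(S, 𝓕)` returned by the algorithm on input `G` and `X 0, …, X (k + 1)`. -/
noncomputable def algorithm (G : SimpleGraph V) (k : ℕ) (X : ℕ → Set V)
    (fas : Set V → Set V → Set (V × V)) : Set V × Set (Set V) :=
  let σ := run G k X fas { t := 0, S := ∅, A := ∅, forts := ∅ }
  (σ.S, σ.forts)

/-- Choices of representatives exist on every finite graph. -/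
theorem exists_isForcingArcChoice [Finite V] (G : SimpleGraph V) :
    ∃ fas : Set V → Set V → Set (V × V), IsForcingArcChoice G fas := by
  have key : ∀ (U S : Set V), IsZeroForcingSetOn G U S → ∀ (n : ℕ) (B : Set V), S ⊆ B → B ⊆ U →
      (U \ B).ncard = n → ∃ A, ForcingRun G U B A := by
    intro U S hS n
    induction n with
    | zero =>
      intro B _ hBU hn
      have h0 : U \ B = ∅ := (Set.ncard_eq_zero (Set.toFinite _)).1 hn
      have : B = U := hBU.antisymm (Set.sdiff_eq_empty.1 h0)
      subst this
      exact ⟨∅, ForcingRun.done⟩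
    | succ n ih =>
      intro B hSB hBU hn
      have hex : ∃ u v, Forces G U B u v := by
        by_contra hno
        have hcl : ∀ v, Derived G U S v → v ∈ B := by
          intro v hv
          induction hv with
          | init hv => exact hSB hv
          | @force u v hu hv huv _ _ ihu ihr =>
            by_contra hvB
            refine hno ⟨u, v, hu, ihu, hv, hvB, huv, fun w hw huw hwB => ?_⟩
            by_contra hne
            exact hwB (ihr w hw huw hne)
        have : U \ B = ∅ := Set.sdiff_eq_empty.2 fun v hv => hcl v (hS.2 v hv)
        rw [this, Set.ncard_empty] at hn
        omega
      obtain ⟨u, v, huv⟩ := hex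
      obtain ⟨_, _, hvU, hvB, _⟩ := id huv
      have hd : U \ (B ∪ {v}) = (U \ B) \ {v} := by rw [Set.sdiff_sdiff]
      obtain ⟨A, hA⟩ := ih (B ∪ {v}) (hSB.trans Set.subset_union_left)
        (Set.union_subset hBU (Set.singleton_subset_iff.2 hvU)) (by
          have hm : v ∈ U \ B := ⟨hvU, hvB⟩
          rw [hd, Set.ncard_sdiff_singleton_of_mem hm, hn]; rfl)
      exact ⟨_, ForcingRun.step huv hA⟩
  have key' : ∀ U S : Set V, ∃ A, IsZeroForcingSetOn G U S → IsForcingArcSetFrom G U S A := by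
    intro U S
    by_cases h : IsZeroForcingSetOn G U S
    · obtain ⟨A, hA⟩ := key U S h _ S subset_rfl h.1 rfl
      exact ⟨A, fun _ => ⟨h.1, hA⟩⟩
    · exact ⟨∅, fun h' => absurd h' h⟩
  choose f hf using key'
  exact ⟨f, hf⟩

end ZeroForcing

namespace ZeroForcing

variable {V : Type*}

/-! The sources of any arc set that can be scheduled consistently with the colour change rule form a
zero forcing set (`derived_sources`), so it suffices to keep `A` schedulable. The invariant is that
`A` is a timed chain set of `G(0, t)` with no arc into `X t`. Reversing `A` reverses time, and then
no arc leaves `X t`. The new arcs on `G(t, z)` do not enter `X t`, since `X t` is blue from the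
start. As `X t` separates the two sides, all old arcs can be used before all new ones (`union`).
Deleting the arcs into `X z` restores the invariant. After the last round the sources of the whole
arc set lie in the returned `S`. -/

/-- `A` is a set of arcs of `G[U]` with in- and out-degrees at most one, together with a time
function `f` under which `A` is compatible with the colour change rule: when `u` forces `v`, every
arc into `u`, or into a neighbour of `u` in `U` other than `v`, has been used before. -/
structure IsTimedChainSet (G : SimpleGraph V) (U : Set V) (A : Set (V × V)) (f : V × V → ℤ) :
    Prop where
  left_mem : ∀ {u v}, (u, v) ∈ A → u ∈ U
  right_mem : ∀ {u v}, (u, v) ∈ A → v ∈ U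
  adj : ∀ {u v}, (u, v) ∈ A → G.Adj u v
  in_unique : ∀ {u u' v}, (u, v) ∈ A → (u', v) ∈ A → u = u'
  out_unique : ∀ {u v v'}, (u, v) ∈ A → (u, v') ∈ A → v = v'
  lt_self : ∀ {u v x}, (u, v) ∈ A → (x, u) ∈ A → f (x, u) < f (u, v)
  lt_adj : ∀ {u v w x}, (u, v) ∈ A → G.Adj u w → w ≠ v → (x, w) ∈ A → f (x, w) < f (u, v)

/-! ### Schedulable arc sets: reversal, sources, gluing. -/

namespace IsTimedChainSet

variable {G : SimpleGraph V} {U : Set V} {A : Set (V × V)} {f : V × V → ℤ}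

theorem mono (h : IsTimedChainSet G U A f) {B : Set (V × V)} (hB : B ⊆ A) :
    IsTimedChainSet G U B f where
  left_mem h1 := h.left_mem (hB h1)
  right_mem h1 := h.right_mem (hB h1)
  adj h1 := h.adj (hB h1)
  in_unique h1 h2 := h.in_unique (hB h1) (hB h2)
  out_unique h1 h2 := h.out_unique (hB h1) (hB h2)
  lt_self h1 h2 := h.lt_self (hB h1) (hB h2)
  lt_adj h1 h2 h3 h4 := h.lt_adj (hB h1) h2 h3 (hB h4)

/-- Reversing a forcing process. -/
theorem reverse (h : IsTimedChainSet G U A f) :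
    IsTimedChainSet G U (ZeroForcing.reverse A) (fun a => -f (a.2, a.1)) where
  left_mem h1 := h.right_mem h1
  right_mem h1 := h.left_mem h1
  adj h1 := (h.adj h1).symm
  in_unique h1 h2 := h.out_unique h1 h2
  out_unique h1 h2 := h.in_unique h1 h2
  lt_self h1 h2 := neg_lt_neg (h.lt_self h2 h1)
  lt_adj {u v w x} h1 h2 h3 h4 := by
    -- In `A`, `w` forces `x` and `u` is another neighbour of `w`, so the arc into `u` comes
    -- earlier; `u = x` would give `u` two incoming arcs.
    refine neg_lt_neg (h.lt_adj (v := x) h4 h2.symm ?_ h1)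
    rintro rfl
    exact h3 (h.in_unique h4 h1)

/-- Every vertex of `U` is derived from the sources of a chain set. -/
theorem derived_sources [Finite V] (h : IsTimedChainSet G U A f) {v : V} (hv : v ∈ U) :
    Derived G U (sources A U) v := by
  have key : ∀ a : V × V, a ∈ A → Derived G U (sources A U) a.2 := by
    have wf : WellFounded (fun a b : V × V => f a < f b) :=
      haveI : IsTrans (V × V) (fun a b => f a < f b) := ⟨fun _ _ _ => lt_trans⟩
      haveI : Std.Irrefl (fun a b : V × V => f a < f b) := ⟨fun _ => lt_irrefl _⟩
      Finite.wellFounded_of_trans_of_irrefl _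
    intro a
    induction a using wf.induction with
    | _ a ih =>
      obtain ⟨u, v⟩ := a
      intro ha
      have aux : ∀ w ∈ U, (∀ x, (x, w) ∈ A → f (x, w) < f (u, v)) →
          Derived G U (sources A U) w := by
        intro w hw hlt
        by_cases hs : ∃ x, (x, w) ∈ A
        · obtain ⟨x, hx⟩ := hs
          exact ih (x, w) (hlt x hx) hx
        · exact .init ⟨hw, fun x hx => hs ⟨x, hx⟩⟩
      exact .force (h.left_mem ha) (h.right_mem ha) (h.adj ha)
        (aux u (h.left_mem ha) fun x hx => h.lt_self ha hx)
        fun w hw huw hne => aux w hw fun x hx => h.lt_adj ha huw hne hx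
  by_cases hs : ∃ x, (x, v) ∈ A
  · obtain ⟨x, hx⟩ := hs
    exact key _ hx
  · exact .init ⟨hv, fun x hx => hs ⟨x, hx⟩⟩

/-- Two chain sets on vertex sets `U`, `U'` that are separated by `T` can be run one after the
other, provided that no arc of the first leaves `T` and no arc of the second enters `T`. -/
theorem union [Finite V] (h : IsTimedChainSet G U A f) {U' : Set V} {A' : Set (V × V)}
    {f' : V × V → ℤ} (h' : IsTimedChainSet G U' A' f') {T : Set V} (hT : U ∩ U' ⊆ T)
    (hsep : ∀ u ∈ U, ∀ w ∈ U', G.Adj u w → u ∈ T ∨ w ∈ T)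
    (hA : ∀ u v, (u, v) ∈ A → u ∉ T) (hA' : ∀ u v, (u, v) ∈ A' → v ∉ T) :
    ∃ g, IsTimedChainSet G (U ∪ U') (A ∪ A') g := by
  classical
  -- Shifting `f'` by `M + 1` puts every arc of `A'` strictly after every arc of `A`.
  obtain ⟨M, hM⟩ := (Set.finite_range fun p : (V × V) × (V × V) => f p.1 - f' p.2).bddAbove
  have hM' : ∀ a b, f a < f' b + (M + 1) := by
    intro a b
    have : f a - f' b ≤ M := hM ⟨(a, b), rfl⟩
    linarith
  have hdisj : ∀ {u u' v}, (u, v) ∈ A → (u', v) ∈ A' → False := fun h1 h2 =>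
    hA' _ _ h2 (hT ⟨h.right_mem h1, h'.right_mem h2⟩)
  have hdisj' : ∀ {u v v'}, (u, v) ∈ A → (u, v') ∈ A' → False := fun h1 h2 =>
    hA _ _ h1 (hT ⟨h.left_mem h1, h'.left_mem h2⟩)
  set g : V × V → ℤ := fun a => if a ∈ A then f a else f' a + (M + 1)
  have hgA : ∀ {a}, a ∈ A → g a = f a := fun ha => if_pos ha
  have hgA' : ∀ {u v}, (u, v) ∈ A' → g (u, v) = f' (u, v) + (M + 1) := fun ha =>
    if_neg fun h1 => hdisj h1 ha
  refine ⟨g, ?_, ?_, ?_, ?_, ?_, ?_, ?_⟩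
  · exact fun h1 => h1.imp h.left_mem h'.left_mem
  · exact fun h1 => h1.imp h.right_mem h'.right_mem
  · exact fun h1 => h1.elim h.adj h'.adj
  · rintro u u' v (h1 | h1) (h2 | h2)
    · exact h.in_unique h1 h2
    · exact (hdisj h1 h2).elim
    · exact (hdisj h2 h1).elim
    · exact h'.in_unique h1 h2
  · rintro u v v' (h1 | h1) (h2 | h2)
    · exact h.out_unique h1 h2
    · exact (hdisj' h1 h2).elim
    · exact (hdisj' h2 h1).elim
    · exact h'.out_unique h1 h2
  · rintro u v x (h1 | h1) (h2 | h2)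
    · rw [hgA h1, hgA h2]
      exact h.lt_self h1 h2
    · exact (hA _ _ h1 (hT ⟨h.left_mem h1, h'.right_mem h2⟩)).elim
    · rw [hgA' h1, hgA h2]
      exact hM' _ _
    · rw [hgA' h1, hgA' h2]
      exact add_lt_add_left (h'.lt_self h1 h2) _
  · rintro u v w x (h1 | h1) h3 h4 (h2 | h2)
    · rw [hgA h1, hgA h2]
      exact h.lt_adj h1 h3 h4 h2
    · exact ((hsep _ (h.left_mem h1) _ (h'.right_mem h2) h3).elim (hA _ _ h1) (hA' _ _ h2)).elim
    · rw [hgA' h1, hgA h2]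
      exact hM' _ _
    · rw [hgA' h1, hgA' h2]
      exact add_lt_add_left (h'.lt_adj h1 h3 h4 h2) _

end IsTimedChainSet

/-- The arc set of a forcing run from `B` is a chain set whose arcs enter exactly the vertices
outside `B`. -/
theorem ForcingRun.exists_isTimedChainSet [Finite V] {G : SimpleGraph V} {U B : Set V}
    {A : Set (V × V)} (h : ForcingRun G U B A) :
    (∃ f, IsTimedChainSet G U A f) ∧ (∀ u v, (u, v) ∈ A → v ∉ B) ∧
      ∀ v ∈ U, v ∉ B → ∃ u, (u, v) ∈ A := by
  classical
  induction h with
  | done =>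
    exact ⟨⟨0, by constructor <;> simp⟩, by simp, fun v hv hv' => (hv' hv).elim⟩
  | @step B A u v huv _ ih =>
    obtain ⟨⟨f, hf⟩, hhead, hcov⟩ := ih
    obtain ⟨huU, huB, hvU, hvB, hadj, huniq⟩ := huv
    -- The arc added by the induction is the first force of the run, so it gets the time `M - 1`,
    -- below all others.
    obtain ⟨M, hM⟩ := (Set.finite_range f).bddBelow
    have hM' : ∀ a, M - 1 < f a := fun a => by
      have : M ≤ f a := hM ⟨a, rfl⟩
      linarith
    have hB : ∀ {x w}, (x, w) ∈ A → w ∉ B := fun h1 h2 => hhead _ _ h1 (.inl h2)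
    have hv : ∀ {x}, (x, v) ∉ A := fun h1 => hhead _ _ h1 (.inr rfl)
    -- Once `v` is blue, `u` has no white neighbour left to force.
    have hu : ∀ {w}, (u, w) ∉ A := fun {w} h1 => by
      have := huniq w (hf.right_mem h1) (hf.adj h1) (hB h1)
      exact hv (this ▸ h1)
    set g : V × V → ℤ := Function.update f (u, v) (M - 1)
    have hg0 : g (u, v) = M - 1 := Function.update_self ..
    have hgA : ∀ {a}, a ∈ A → g a = f a := fun {a} ha =>
      Function.update_of_ne (fun h => hv (h ▸ ha)) ..
    refine ⟨⟨g, ?_, ?_, ?_, ?_, ?_, ?_, ?_⟩, ?_, ?_⟩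
    · rintro x y (h1 | h1)
      · exact hf.left_mem h1
      · cases h1; exact huU
    · rintro x y (h1 | h1)
      · exact hf.right_mem h1
      · cases h1; exact hvU
    · rintro x y (h1 | h1)
      · exact hf.adj h1
      · cases h1; exact hadj
    · rintro x x' y (h1 | h1) (h2 | h2)
      · exact hf.in_unique h1 h2
      · cases h2; exact (hv h1).elim
      · cases h1; exact (hv h2).elim
      · cases h1; cases h2; rfl
    · rintro x y y' (h1 | h1) (h2 | h2)
      · exact hf.out_unique h1 h2
      · cases h2; exact (hu h1).elim
      · cases h1; exact (hu h2).elim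
      · cases h1; cases h2; rfl
    · rintro x y w (h1 | h1) (h2 | h2)
      · rw [hgA h1, hgA h2]
        exact hf.lt_self h1 h2
      · cases h2
        rw [hg0, hgA h1]
        exact hM' _
      · cases h1; exact (hB h2 huB).elim
      · cases h1; cases h2; exact (hvB huB).elim
    · rintro x y w x' (h1 | h1) h3 h4 (h2 | h2)
      · rw [hgA h1, hgA h2]
        exact hf.lt_adj h1 h3 h4 h2
      · cases h2
        rw [hg0, hgA h1]
        exact hM' _
      · cases h1
        exact (h4 (huniq w (hf.right_mem h2) h3 (hB h2))).elim
      · cases h1; cases h2; exact (h4 rfl).elim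
    · rintro x y (h1 | h1)
      · exact hB h1
      · cases h1; exact hvB
    · intro w hw hwB
      by_cases hwv : w = v
      · exact ⟨u, .inr (by rw [hwv]; rfl)⟩
      · obtain ⟨x, hx⟩ := hcov w hw (by rintro (h | h); exacts [hwB h, hwv h])
        exact ⟨x, .inl hx⟩

/-! ### Derived colourings, unions of bags and the inner loop. -/

theorem Derived.mono {G : SimpleGraph V} {U S : Set V} {v : V} (h : Derived G U S v)
    {S' : Set V} (hS : S ⊆ S') : Derived G U S' v := by
  induction h with
  | init hv => exact .init (hS hv)
  | force hu hv huv _ _ ih ih' => exact .force hu hv huv ih ih'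

/-- Additional vertices that are blue from the start block no force. -/
theorem Derived.union {G : SimpleGraph V} {U S : Set V} {v : V} (h : Derived G U S v)
    (T : Set V) : Derived G (U ∪ T) (S ∪ T) v := by
  induction h with
  | init hv => exact .init (.inl hv)
  | force hu hv huv _ _ ih ih' =>
    refine .force (.inl hu) (.inl hv) huv ih ?_
    rintro w (hw | hw) huw hne
    · exact ih' w hw huw hne
    · exact .init (.inr hw)

theorem white_eq_empty_iff {G : SimpleGraph V} {U S : Set V} :
    white G U S = ∅ ↔ ∀ v ∈ U, Derived G U S v := by
  simp [white, Set.eq_empty_iff_forall_notMem]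

theorem bagUnion_union (X : ℕ → Set V) {i j l : ℕ} (hij : i ≤ j) (hjl : j ≤ l) :
    bagUnion X i j ∪ bagUnion X j l = bagUnion X i l := by
  ext v
  constructor
  · rintro (⟨s, h1, h2, h3⟩ | ⟨s, h1, h2, h3⟩)
    · exact ⟨s, h1, by omega, h3⟩
    · exact ⟨s, by omega, h2, h3⟩
  · rintro ⟨s, h1, h2, h3⟩
    rcases le_total s j with h | h
    · exact .inl ⟨s, h1, h, h3⟩
    · exact .inr ⟨s, h, h2, h3⟩

theorem bagUnion_succ (X : ℕ → Set V) {i j : ℕ} (hij : i ≤ j) :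
    bagUnion X i (j + 1) = bagUnion X i j ∪ X (j + 1) := by
  ext v
  constructor
  · rintro ⟨s, h1, h2, h3⟩
    rcases Nat.lt_or_eq_of_le h2 with h | rfl
    · exact .inl ⟨s, h1, by omega, h3⟩
    · exact .inr h3
  · rintro (⟨s, h1, h2, h3⟩ | h)
    · exact ⟨s, h1, by omega, h3⟩
    · exact ⟨j + 1, by omega, le_rfl, h⟩

theorem subset_bagUnion (X : ℕ → Set V) {i s j : ℕ} (his : i ≤ s) (hsj : s ≤ j) :
    X s ⊆ bagUnion X i j := fun _ hv => ⟨s, his, hsj, hv⟩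

theorem white_bagUnion_self (G : SimpleGraph V) (X : ℕ → Set V) (t : ℕ) :
    white G (bagUnion X t t) (X t ∪ X t) = ∅ := by
  rw [white_eq_empty_iff]
  rintro v ⟨s, h1, h2, h3⟩
  obtain rfl : s = t := le_antisymm h2 h1
  exact .init (.inl h3)

/-- Carrying `h0` through the induction makes the index just before a failure available as a
success. -/
theorem scan_spec (G : SimpleGraph V) (k : ℕ) (X : ℕ → Set V) (t z : ℕ) (hz : z ≤ k + 1)
    (htz : t ≤ z) (h0 : white G (bagUnion X t z) (X t ∪ X z) = ∅) :
    (scan G k X t z ∅).2 =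
        white G (bagUnion X t (scan G k X t z ∅).1) (X t ∪ X (scan G k X t z ∅).1) ∧
      ((scan G k X t z ∅).2 = ∅ → (scan G k X t z ∅).1 = k + 1) ∧
      ((scan G k X t z ∅).2 ≠ ∅ → ∃ y, t ≤ y ∧ y ≤ k ∧ (scan G k X t z ∅).1 = y + 1 ∧
        white G (bagUnion X t y) (X t ∪ X y) = ∅) := by
  induction hn : k + 1 - z generalizing z with
  | zero =>
    obtain rfl : z = k + 1 := by omega
    rw [scan, if_neg (by omega)]
    exact ⟨h0.symm, fun _ => rfl, fun h => (h rfl).elim⟩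
  | succ n ih =>
    rw [scan, if_pos ⟨rfl, by omega⟩]
    by_cases hW : white G (bagUnion X t (z + 1)) (X t ∪ X (z + 1)) = ∅
    · rw [hW]
      exact ih (z + 1) (by omega) (by omega) hW (by omega)
    · rw [scan, if_neg fun h => hW h.1]
      exact ⟨rfl, fun h => (hW h).elim, fun _ => ⟨z, htz, by omega, rfl, h0⟩⟩

/-! ### Bags as separators. -/

namespace IsNicePathDecomposition

variable {G : SimpleGraph V} {k : ℕ} {X : ℕ → Set V}

/-- The interval property extends to the indices `0` and `k + 1` because those bags are empty. -/
theorem mem_of_le (hX : IsNicePathDecomposition G k X) {v : V} {i s j : ℕ} (his : i ≤ s)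
    (hsj : s ≤ j) (hj : j ≤ k + 1) (hi : v ∈ X i) (hvj : v ∈ X j) : v ∈ X s := by
  rcases Nat.eq_zero_or_pos i with rfl | hi0
  · simp [hX.first_empty] at hi
  rcases Nat.lt_or_eq_of_le hj with hj | rfl
  · rcases Nat.lt_or_eq_of_le (his.trans hsj) with hij | rfl
    · exact hX.interval v i j hi0 hij (by omega) hi hvj s his hsj
    · obtain rfl : s = i := le_antisymm hsj his
      exact hi
  · simp [hX.last_empty] at hvj

theorem inter_subset (hX : IsNicePathDecomposition G k X) {i t z : ℕ} (hz : z ≤ k + 1) :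
    bagUnion X i t ∩ bagUnion X t z ⊆ X t := by
  rintro v ⟨⟨s, _, h1, h2⟩, ⟨s', h3, h4, h5⟩⟩
  exact hX.mem_of_le h1 h3 (by omega) h2 h5

theorem separates (hX : IsNicePathDecomposition G k X) {i t z : ℕ} (hz : z ≤ k + 1) :
    ∀ u ∈ bagUnion X i t, ∀ w ∈ bagUnion X t z, G.Adj u w → u ∈ X t ∨ w ∈ X t := by
  rintro u ⟨s, _, h1, h2⟩ w ⟨s', h3, h4, h5⟩ huw
  obtain ⟨j, _, hjk, huj, hwj⟩ := hX.edge_mem u w huw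
  rcases le_total j t with h | h
  · exact .inr (hX.mem_of_le h h3 (by omega) hwj h5)
  · exact .inl (hX.mem_of_le h1 h (by omega) h2 huj)

theorem bagUnion_eq_univ (hX : IsNicePathDecomposition G k X) :
    bagUnion X 0 (k + 1) = Set.univ := by
  refine Set.eq_univ_of_forall fun v => ?_
  obtain ⟨i, _, hi, hv⟩ := hX.vertex_mem v
  exact ⟨i, by omega, by omega, hv⟩

/-- If forcing from `X t ∪ X z` gets stuck for the first time at `z = y + 1`, then `X t ∪ X y` is
still a zero forcing set of `G(t, y + 1)`. -/
theorem isZeroForcingSetOn_of_white (hX : IsNicePathDecomposition G k X) {t y : ℕ} (hty : t ≤ y)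
    (hyk : y ≤ k) (hy : white G (bagUnion X t y) (X t ∪ X y) = ∅)
    (hy' : white G (bagUnion X t (y + 1)) (X t ∪ X (y + 1)) ≠ ∅) :
    IsZeroForcingSetOn G (bagUnion X t (y + 1)) (X t ∪ X y) := by
  rw [white_eq_empty_iff] at hy
  refine ⟨Set.union_subset (subset_bagUnion X le_rfl (by omega))
    (subset_bagUnion X hty (by omega)), ?_⟩
  -- Introducing a vertex adds it as blue and keeps `X y` blue, so nothing would stay white. Hence a
  -- vertex is removed, and the union of bags does not change.
  rcases hX.succ_bag y hyk with ⟨v, _, hv⟩ | ⟨v, _, hv⟩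
  · refine (hy' (white_eq_empty_iff.2 ?_)).elim
    rw [bagUnion_succ X hty]
    rintro w (hw | hw)
    · refine ((hy w hw).union (X (y + 1))).mono ?_
      have hsub : X y ⊆ X (y + 1) := hv ▸ Set.subset_union_left
      rw [Set.union_assoc, Set.union_eq_right.2 hsub]
    · exact .init (.inr hw)
  · have : bagUnion X t (y + 1) = bagUnion X t y := by
      rw [bagUnion_succ X hty, Set.union_eq_left]
      exact (hv ▸ Set.sdiff_subset : X (y + 1) ⊆ X y).trans (subset_bagUnion X hty le_rfl)
    rwa [this]

end IsNicePathDecomposition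

/-! ### The invariant of the outer loop. -/

/-- From a state whose arcs form a chain set of `G(0, t)` without arcs into `X t`, the algorithm
returns a zero forcing set. -/
theorem isZeroForcingSet_run [Finite V] {G : SimpleGraph V} {k : ℕ} {X : ℕ → Set V}
    (hX : IsNicePathDecomposition G k X) {fas : Set V → Set V → Set (V × V)}
    (hfas : IsForcingArcChoice G fas) (σ : State V) (ht : σ.t ≤ k + 1)
    (hA : ∃ f, IsTimedChainSet G (bagUnion X 0 σ.t) σ.A f)
    (hhead : ∀ u v, (u, v) ∈ σ.A → v ∉ X σ.t) :
    IsZeroForcingSet G (run G k X fas σ).S := by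
  induction hn : k + 1 - σ.t using Nat.strong_induction_on generalizing σ with
  | _ n ih =>
    obtain ⟨f, hf⟩ := hA
    obtain ⟨h1, h2, h3⟩ := scan_spec G k X σ.t σ.t ht le_rfl (white_bagUnion_self G X σ.t)
    have htail : ∀ u v, (u, v) ∈ reverse σ.A → u ∉ X σ.t := fun u v h => hhead v u h
    rw [run]
    split_ifs with hW
    · obtain ⟨y, hty, hyk, hz, hy⟩ := h3 hW
      rw [h1, hz] at hW
      have hfas' := (hfas _ _ (hX.isZeroForcingSetOn_of_white hty hyk hy hW)).2
      obtain ⟨⟨g, hg⟩, hgB, -⟩ := hfas'.exists_isTimedChainSet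
      obtain ⟨f', hf'⟩ := hf.reverse.union hg (hX.inter_subset (by omega))
        (hX.separates (by omega)) htail fun u v h h' => hgB u v h (.inl h')
      rw [bagUnion_union X (Nat.zero_le _) (by omega)] at hf'
      simp only [hz, Nat.add_sub_cancel]
      exact ih (k + 1 - (y + 1)) (by omega) _ (by dsimp only; omega)
        ⟨f', hf'.mono fun _ h => h.1⟩ (fun u v h => h.2) rfl
    · rw [not_not] at hW
      have hz := h2 hW
      -- The scan ran to the empty last bag, so `X t` alone forces all of `G(t, k + 1)`.
      rw [hW, hz, hX.last_empty, Set.union_empty] at h1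
      have hfas' := (hfas _ _
        ⟨subset_bagUnion X le_rfl ht, white_eq_empty_iff.1 h1.symm⟩).2
      obtain ⟨⟨g, hg⟩, hgB, hcov⟩ := hfas'.exists_isTimedChainSet
      obtain ⟨f', hf'⟩ := hf.reverse.union hg (hX.inter_subset le_rfl)
        (hX.separates le_rfl) htail hgB
      rw [bagUnion_union X (Nat.zero_le _) ht, hX.bagUnion_eq_univ] at hf'
      refine ⟨Set.subset_univ _, fun v _ => (hf'.derived_sources (Set.mem_univ v)).mono ?_⟩
      -- A source of the final arc set lies in `G(0, t)`: every other vertex lies outside `X t` and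
      -- is entered by an arc of the last forcing run.
      rintro w ⟨-, hw⟩
      refine ⟨?_, fun u hu => hw u (.inl hu)⟩
      by_contra hw'
      have hwU : w ∈ bagUnion X 0 σ.t ∪ bagUnion X σ.t (k + 1) := by
        rw [bagUnion_union X (Nat.zero_le _) ht, hX.bagUnion_eq_univ]
        trivial
      obtain ⟨u, hu⟩ := hcov w (hwU.resolve_left hw')
        fun h => hw' (subset_bagUnion X (Nat.zero_le _) le_rfl h)
      exact hw u (.inr hu)

end ZeroForcing

theorem mainTheorem4 {V : Type*} [Finite V] (G : SimpleGraph V) (k : ℕ) (X : ℕ → Set V)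
    (hX : ZeroForcing.IsNicePathDecomposition G k X)
    (fas : Set V → Set V → Set (V × V)) (hfas : ZeroForcing.IsForcingArcChoice G fas) :
    ZeroForcing.IsZeroForcingSet G (ZeroForcing.algorithm G k X fas).1 :=
  ZeroForcing.isZeroForcingSet_run hX hfas _ (Nat.zero_le _)
    ⟨0, by constructor <;> simp⟩ (by simp)
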